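/- All graphs are finite, simple and undirected. For a graph $G$, let $\alpha(G)$ be its independence number and let $\rho(G)$ be its spectral radius, that is, the largest eigenvalue of its adjacency matrix. Let $K_m$ be the complete graph on $m$ vertices, $\cup$ the disjoint union of graphs, and $G_1\vee G_2$ the join, obtained from $G_1\cup G_2$ by adding all edges between a vertex of $G_1$ and a vertex of $G_2$. A leaf of a tree $T$ is a vertex of degree $1$ in $T$, and the leaf distance of $T$ is the minimum of the distances in $T$ between two distinct leaves of $T$. **Theorem 1.1.** Let $G$ be a connected graph of order $n$ with $\alpha(G)\le 5$, and let $d$ be a positive integer with $16\le d^{2}\le n$. If $$\rho(G)\ \ge\ \rho\bigl(K_{\lceil d/2\rceil-1}\vee(K_{n-\lceil d/2\rceil}\cup K_1)\bigr),$$ then $G$ has a spanning tree with leaf distance at least $d$, or $G$ is isomorphic to $K_{\lceil d/2\rceil-1}\vee(K_{n-\lceil d/2\rceil}\cup K_1)$. -/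

import Mathlib

namespace LeafDistance

/-- The join `G ∨ H` of two vertex-disjoint graphs: the disjoint union of `G` and `H` together with
all edges between a vertex of `G` and a vertex of `H`. -/
def join {V W : Type*} (G : SimpleGraph V) (H : SimpleGraph W) : SimpleGraph (V ⊕ W) where
  Adj
    | Sum.inl u, Sum.inl v => G.Adj u v
    | Sum.inr u, Sum.inr v => H.Adj u v
    | _, _ => True
  symm := ⟨by
    rintro (u | u) (v | v) h
    · exact G.adj_symm h
    · trivial
    · trivial
    · exact H.adj_symm h⟩
  loopless := ⟨by
    rintro (u | u) h
    · exact G.loopless.irrefl u h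
    · exact H.loopless.irrefl u h⟩

open Classical in
/-- The spectral radius `ρ(G) = λ₁(G)` of a finite graph: the largest eigenvalue of its (real
symmetric) adjacency matrix. For a nonempty vertex set the real spectrum of that matrix is a finite
nonempty set, so the supremum is a maximum. -/
noncomputable def rho {V : Type*} [Fintype V] (G : SimpleGraph V) : ℝ :=
  sSup (spectrum ℝ (G.adjMatrix ℝ))

/-- A leaf of `T` is a vertex of degree one in `T`. -/
def IsLeaf {V : Type*} (T : SimpleGraph V) (v : V) : Prop :=
  (T.neighborSet v).ncard = 1

/-- The leaf distance of `T`: the minimum of the distances in `T` between two distinct leaves.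
A finite tree with at least two vertices has at least two leaves, so that the minimum exists. -/
noncomputable def leafDist {V : Type*} (T : SimpleGraph V) : ℕ :=
  sInf {k | ∃ u v : V, u ≠ v ∧ IsLeaf T u ∧ IsLeaf T v ∧ T.dist u v = k}

/-- `T` is a spanning tree of `G`: a tree on the whole vertex set all of whose edges lie in `G`. -/
def IsSpanningTree {V : Type*} (T G : SimpleGraph V) : Prop :=
  T ≤ G ∧ T.IsTree

/-- The graph `K_{⌈d/2⌉-1} ∨ (K_{n-⌈d/2⌉} ∪ K₁)`, for `1 ≤ ⌈d/2⌉ ≤ n`. -/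
def extremalGraph (n d : ℕ) :
    SimpleGraph (Fin (⌈(d : ℚ) / 2⌉₊ - 1) ⊕ (Fin (n - ⌈(d : ℚ) / 2⌉₊) ⊕ Fin 1)) :=
  join (SimpleGraph.completeGraph (Fin (⌈(d : ℚ) / 2⌉₊ - 1)))
    (SimpleGraph.sum (SimpleGraph.completeGraph (Fin (n - ⌈(d : ℚ) / 2⌉₊)))
      (SimpleGraph.completeGraph (Fin 1)))

end LeafDistance

/-! The first alternative always holds, because `G` has a Hamiltonian path. The extremal graph
contains a clique on n - 1 vertices, so ρ(G) ≥ n - 2. Hong's bound `rho_sq_le` turns this into 2m ≥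
(n - 2)² + (n - 1), whose right side is odd, so 2m ≥ (n - 1)(n - 2) + 2: at most n - 2 edges are
missing.

Non-adjacent x and y account for 2(n - 1) - deg x - deg y - 1 missing edges, which forces deg x +
deg y ≥ n - 1. This is Ore's condition, and `exists_isChain_of_ore` gives a Hamiltonian path. Its
ends are its only leaves, at distance n - 1 ≥ d. -/

namespace LeafDistance

open Finset

/-! ### Spectral radius: clique lower bound and Hong's upper bound -/

section Spectral

open Matrix

/-- The Rayleigh quotient of a real symmetric matrix is bounded by its largest eigenvalue. -/
theorem dotProduct_mulVec_le_sSup_spectrum {V : Type*} [Fintype V] [DecidableEq V]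
    {A : Matrix V V ℝ} (hA : A.IsHermitian) (x : V → ℝ) :
    x ⬝ᵥ (A *ᵥ x) ≤ sSup (spectrum ℝ A) * (x ⬝ᵥ x) := by
  set c := sSup (spectrum ℝ A) with hc
  have hB : (c • (1 : Matrix V V ℝ) - A).IsHermitian := by
    refine IsHermitian.sub ?_ hA
    rw [Matrix.IsHermitian, conjTranspose_smul, conjTranspose_one, star_trivial]
  -- An eigenvalue μ of c·1 - A makes c - μ an eigenvalue of `A`, so c - μ ≤ c.
  have hpos : (c • (1 : Matrix V V ℝ) - A).PosSemidef := by
    refine hB.posSemidef_iff_eigenvalues_nonneg.2 fun i => ?_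
    have hi := hB.eigenvalues_mem_spectrum_real i
    have hmem : c - hB.eigenvalues i ∈ spectrum ℝ A := by
      rw [spectrum.mem_iff] at hi ⊢
      intro hu
      apply hi
      convert hu.neg using 1
      rw [Algebra.algebraMap_eq_smul_one, Algebra.algebraMap_eq_smul_one, sub_smul]
      abel
    have hle := le_csSup (Matrix.finite_real_spectrum (A := A)).bddAbove hmem
    simp only [Pi.zero_apply]
    linarith
  have h := hpos.dotProduct_mulVec_nonneg x
  rw [sub_mulVec, smul_mulVec, one_mulVec, star_trivial, dotProduct_sub, dotProduct_smul,
    smul_eq_mul] at h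
  linarith

/-- The largest eigenvalue of a real symmetric matrix is attained at an eigenvector. -/
theorem exists_mulVec_eq_sSup_spectrum_smul {V : Type*} [Fintype V] [DecidableEq V] [Nonempty V]
    {A : Matrix V V ℝ} (hA : A.IsHermitian) :
    ∃ x : V → ℝ, x ≠ 0 ∧ A *ᵥ x = sSup (spectrum ℝ A) • x := by
  have hne : (spectrum ℝ A).Nonempty :=
    ⟨_, hA.eigenvalues_mem_spectrum_real (Classical.arbitrary V)⟩
  have hmem := hne.csSup_mem (Matrix.finite_real_spectrum (A := A))
  rw [hA.spectrum_real_eq_range_eigenvalues] at hmem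
  obtain ⟨i, hi⟩ := hmem
  refine ⟨hA.eigenvectorBasis i, fun h => ?_, ?_⟩
  · exact hA.eigenvectorBasis.toBasis.ne_zero i (by ext j; simpa using congrFun h j)
  · rw [hA.mulVec_eigenvectorBasis i, hi, hA.spectrum_real_eq_range_eigenvalues]

theorem isHermitian_adjMatrix {V : Type*} (G : SimpleGraph V) [DecidableRel G.Adj] :
    (G.adjMatrix ℝ).IsHermitian := by
  rw [Matrix.IsHermitian, conjTranspose_eq_transpose_of_trivial, SimpleGraph.transpose_adjMatrix]

open Classical in
/-- A graph with a clique on `s` has spectral radius at least `#s - 1`. -/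
theorem card_sub_one_le_rho {V : Type*} [Fintype V] (G : SimpleGraph V) (s : Finset V)
    (hs : s.Nonempty) (hG : G.IsClique s) : (#s : ℝ) - 1 ≤ rho G := by
  have h := dotProduct_mulVec_le_sSup_spectrum (isHermitian_adjMatrix G)
    (fun v => if v ∈ s then 1 else 0)
  change _ ≤ rho G * _ at h
  have h1 : (fun v => if v ∈ s then (1 : ℝ) else 0) ⬝ᵥ (fun v => if v ∈ s then (1 : ℝ) else 0)
      = #s := by
    simp [dotProduct]
  have h2 : (fun v => if v ∈ s then (1 : ℝ) else 0) ⬝ᵥ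
      (G.adjMatrix ℝ *ᵥ fun v => if v ∈ s then (1 : ℝ) else 0) = #s * (#s - 1) := by
    have : ∀ v ∈ s, (G.adjMatrix ℝ *ᵥ fun v => if v ∈ s then (1 : ℝ) else 0) v = #s - 1 := by
      intro v hv
      have he : {w ∈ G.neighborFinset v | w ∈ s} = s.erase v := by
        ext w
        simp only [mem_filter, SimpleGraph.mem_neighborFinset, mem_erase]
        exact ⟨fun h => ⟨h.1.ne', h.2⟩, fun h => ⟨hG hv h.2 h.1.symm, h.2⟩⟩
      rw [SimpleGraph.adjMatrix_mulVec_apply, sum_boole, he, card_erase_of_mem hv,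
        Nat.cast_pred (card_pos.2 hs)]
    simp only [dotProduct, ite_mul, one_mul, zero_mul, sum_ite_mem, univ_inter]
    rw [sum_congr rfl this, sum_const, nsmul_eq_mul]
  rw [h1, h2] at h
  have hpos : (0 : ℝ) < #s := by exact_mod_cast card_pos.2 hs
  nlinarith

/-- Without isolated vertices, the degree sum over a neighbourhood falls short of the total degree
sum by at least `|V| - 1`. -/
theorem sum_degree_neighborFinset_add_le {V : Type*} [Fintype V] (G : SimpleGraph V)
    [DecidableRel G.Adj] (hG : ∀ v, 1 ≤ G.degree v) (v : V) :
    ∑ w ∈ G.neighborFinset v, G.degree w + (Fintype.card V - 1) ≤ ∑ w, G.degree w := by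
  classical
  rw [← sum_add_sum_compl (G.neighborFinset v) fun w => G.degree w]
  -- Outside the neighbourhood, `v` contributes deg v and each of the other n - deg v - 1 vertices
  -- at least 1.
  have hv : v ∈ (G.neighborFinset v)ᶜ := by simp
  have h1 : #((G.neighborFinset v)ᶜ.erase v) ≤
      ∑ w ∈ (G.neighborFinset v)ᶜ.erase v, G.degree w := by
    simpa only [smul_eq_mul, mul_one] using
      card_nsmul_le_sum ((G.neighborFinset v)ᶜ.erase v) (fun w => G.degree w) 1 fun w _ => hG w
  rw [card_erase_of_mem hv, card_compl, SimpleGraph.card_neighborFinset_eq_degree] at h1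
  rw [← add_sum_erase _ _ hv]
  omega

/-- **Hong's bound**: `ρ(G)² ≤ 2m - (n - 1)` for a graph without isolated vertices. -/
theorem rho_sq_le {V : Type*} [Fintype V] [Nonempty V] (G : SimpleGraph V) [DecidableRel G.Adj]
    (hG : ∀ v, 1 ≤ G.degree v) :
    rho G ^ 2 + ((Fintype.card V - 1 : ℕ) : ℝ) ≤ ((∑ v, G.degree v : ℕ) : ℝ) := by
  classical
  obtain ⟨x, hx0, hx⟩ := exists_mulVec_eq_sSup_spectrum_smul (isHermitian_adjMatrix G)
  have hx : ∀ v, ∑ w ∈ G.neighborFinset v, x w = rho G * x v := by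
    intro v
    rw [← SimpleGraph.adjMatrix_mulVec_apply, hx, Pi.smul_apply, smul_eq_mul, rho]
    congr!
  have hpos : 0 < ∑ v, x v ^ 2 := by
    obtain ⟨v, hv⟩ := Function.ne_iff.1 hx0
    exact sum_pos' (fun _ _ => sq_nonneg _) ⟨v, mem_univ v, by
      have : x v ≠ 0 := hv
      positivity⟩
  -- Cauchy–Schwarz in the eigenvector equation at each vertex; exchanging the sums then weights
  -- each x w ^ 2 by the degree sum over the neighbours of w.
  have h1 : rho G ^ 2 * ∑ v, x v ^ 2 ≤
      ∑ v, ∑ w ∈ G.neighborFinset v, (G.degree v : ℝ) * x w ^ 2 := by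
    rw [mul_sum]
    refine sum_le_sum fun v _ => ?_
    rw [← mul_pow, ← hx v, ← mul_sum]
    exact sq_sum_le_card_mul_sum_sq
  have h2 : ∑ v, ∑ w ∈ G.neighborFinset v, (G.degree v : ℝ) * x w ^ 2 =
      ∑ w, x w ^ 2 * ((∑ v ∈ G.neighborFinset w, G.degree v : ℕ) : ℝ) := by
    rw [sum_comm' (t' := univ) (s' := fun w => G.neighborFinset w)
      (by simp [SimpleGraph.adj_comm])]
    refine sum_congr rfl fun w _ => ?_
    rw [Nat.cast_sum, mul_sum]
    exact sum_congr rfl fun v _ => mul_comm _ _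
  have h3 : ∑ w, x w ^ 2 * ((∑ v ∈ G.neighborFinset w, G.degree v : ℕ) : ℝ) ≤
      ∑ w, x w ^ 2 * (((∑ v, G.degree v : ℕ) : ℝ) - ((Fintype.card V - 1 : ℕ) : ℝ)) := by
    refine sum_le_sum fun w _ => mul_le_mul_of_nonneg_left ?_ (sq_nonneg _)
    have := sum_degree_neighborFinset_add_le G hG w
    rw [le_sub_iff_add_le]
    exact_mod_cast this
  rw [← sum_mul] at h3
  have h4 : rho G ^ 2 * ∑ v, x v ^ 2 ≤ (((∑ v, G.degree v : ℕ) : ℝ) -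
      ((Fintype.card V - 1 : ℕ) : ℝ)) * ∑ v, x v ^ 2 := by
    linarith [mul_comm (∑ v, x v ^ 2)
      (((∑ v, G.degree v : ℕ) : ℝ) - ((Fintype.card V - 1 : ℕ) : ℝ))]
  linarith [le_of_mul_le_mul_right h4 hpos]

end Spectral

/-- The clique `K_{n-1}` inside the extremal graph gives `n - 2` as a lower bound on its spectral
radius. -/
theorem sub_two_le_rho_extremalGraph {n d : ℕ} (hn : 2 ≤ n) (hd : 1 ≤ d) (hdn : d ≤ n) :
    (n : ℝ) - 2 ≤ rho (extremalGraph n d) := by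
  classical
  have hc1 : 1 ≤ ⌈(d : ℚ) / 2⌉₊ := Nat.one_le_ceil_iff.2 (by positivity)
  have hc2 : ⌈(d : ℚ) / 2⌉₊ ≤ n := Nat.ceil_le.2 (by
    have : (d : ℚ) ≤ n := by exact_mod_cast hdn
    have : (0 : ℚ) ≤ d := by positivity
    linarith)
  -- `z` is the K₁ vertex; all the others form a clique.
  set z : Fin (⌈(d : ℚ) / 2⌉₊ - 1) ⊕ (Fin (n - ⌈(d : ℚ) / 2⌉₊) ⊕ Fin 1) := .inr (.inr 0) with hz
  have hcard : #({z}ᶜ : Finset _) = n - 1 := by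
    rw [card_compl, card_singleton]
    simp only [Fintype.card_sum, Fintype.card_fin]
    omega
  have h := card_sub_one_le_rho (extremalGraph n d) {z}ᶜ (card_pos.1 (by omega)) (by
    rintro (u | u | u) hu (v | v | v) hv huv <;>
      simp_all [extremalGraph, join, SimpleGraph.completeGraph, Subsingleton.elim _ (0 : Fin 1)])
  rw [hcard, Nat.cast_sub (by omega), Nat.cast_one] at h
  linarith

/-! ### Ore's condition and Hamiltonian paths -/

section Ore

variable {V : Type*}

/-- If `G` misses at most `|V| - 2` edges, non-adjacent vertices satisfy Ore's condition for
Hamiltonian paths. -/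
theorem card_sub_one_le_degree_add_degree [Fintype V] (G : SimpleGraph V) [DecidableRel G.Adj]
    (hm : Fintype.card V * (Fintype.card V - 1) ≤ ∑ v, G.degree v + 2 * (Fintype.card V - 2))
    {x y : V} (hxy : x ≠ y) (h : ¬ G.Adj x y) :
    Fintype.card V - 1 ≤ G.degree x + G.degree y := by
  classical
  have hcard : 2 ≤ Fintype.card V := Fintype.one_lt_card_iff.2 ⟨x, y, hxy⟩
  set s : Finset V := (univ.erase x).erase y with hs
  have hy : y ∈ (univ : Finset V).erase x := by simp [hxy.symm]
  have hscard : #s = Fintype.card V - 2 := by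
    rw [hs, card_erase_of_mem hy, card_erase_of_mem (mem_univ x), card_univ]
    rfl
  have hsum : ∑ v, G.degree v = G.degree x + (G.degree y + ∑ v ∈ s, G.degree v) := by
    rw [hs, add_sum_erase _ (fun v => G.degree v) hy,
      add_sum_erase _ (fun v => G.degree v) (mem_univ x)]
  have hcount : ∀ z : V, ∑ v ∈ s, (if G.Adj v z then 1 else 0) ≤ G.degree z := by
    intro z
    rw [← card_filter, ← SimpleGraph.card_neighborFinset_eq_degree]
    refine card_le_card fun v hv => ?_
    simpa [SimpleGraph.adj_comm] using (mem_filter.1 hv).2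
  -- Summed over the n - 2 vertices of `s`, this bounds the total degree by (n - 2)(n - 3) + 2(deg x
  -- + deg y).
  have hdeg : ∀ v ∈ s, G.degree v ≤ (Fintype.card V - 3) +
      ((if G.Adj v x then 1 else 0) + (if G.Adj v y then 1 else 0)) := by
    intro v hv
    have hsub : G.neighborFinset v ⊆
        s.erase v ∪ (({x} : Finset V).filter (G.Adj v ·) ∪ ({y} : Finset V).filter (G.Adj v ·)) := by
      intro w hw
      have hw : G.Adj v w := by simpa using hw
      by_cases hwx : w = x
      · subst hwx; simp [hw]
      by_cases hwy : w = y
      · subst hwy; simp [hw]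
      simp [hs, hwx, hwy, hw.ne']
    have h1 := card_le_card hsub
    have h2 := card_union_le (s.erase v)
      (({x} : Finset V).filter (G.Adj v ·) ∪ ({y} : Finset V).filter (G.Adj v ·))
    have h3 := card_union_le (({x} : Finset V).filter (G.Adj v ·))
      (({y} : Finset V).filter (G.Adj v ·))
    simp only [card_filter, sum_singleton] at h1 h2 h3
    rw [card_erase_of_mem hv, hscard] at h2
    rw [SimpleGraph.card_neighborFinset_eq_degree] at h1
    omega
  have hS := sum_le_sum hdeg
  rw [sum_add_distrib, sum_add_distrib, sum_const, hscard, smul_eq_mul] at hS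
  have hx := hcount x
  have hy' := hcount y
  obtain ⟨k, hk⟩ := Nat.exists_eq_add_of_le hcard
  rw [hk] at hm hS ⊢
  -- With two vertices the subtraction n - 3 truncates, so that case is separate.
  rcases k with _ | k
  · have hs0 : s = ∅ := card_eq_zero.1 (by omega)
    rw [hsum, hs0, sum_empty] at hm
    omega
  · have e1 : 2 + (k + 1) - 2 = k + 1 := by omega
    have e2 : 2 + (k + 1) - 3 = k := by omega
    have e3 : 2 + (k + 1) - 1 = k + 2 := by omega
    rw [e1, e2] at hS
    rw [e1, e3] at hm
    rw [e3]
    nlinarith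

/-- The number of consecutive pairs of a list that are not adjacent in `G`. -/
def gapCount (G : SimpleGraph V) [DecidableRel G.Adj] : List V → ℕ
  | [] => 0
  | [_] => 0
  | x :: y :: l => (if G.Adj x y then 0 else 1) + gapCount G (y :: l)

variable (G : SimpleGraph V) [DecidableRel G.Adj]

/-- Gaps are additive across a cut; with reversal invariance, only the junctions matter when a
segment is reversed. -/
theorem gapCount_append (l₁ l₂ : List V) (x y : V) :
    gapCount G (l₁ ++ x :: y :: l₂) =
      gapCount G (l₁ ++ [x]) + (if G.Adj x y then 0 else 1) + gapCount G (y :: l₂) := by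
  induction l₁ with
  | nil => simp [gapCount]
  | cons a l ih =>
    cases l with
    | nil => simp [gapCount]; omega
    | cons b l => simp only [List.cons_append, gapCount] at ih ⊢; omega

theorem gapCount_reverse (l : List V) : gapCount G l.reverse = gapCount G l := by
  induction l with
  | nil => rfl
  | cons x l ih =>
    cases l with
    | nil => rfl
    | cons y l =>
      have := gapCount_append G l.reverse [] y x
      simp only [List.reverse_cons, List.append_assoc, List.cons_append, List.nil_append] at this ih ⊢
      rw [this, ih]
      simp only [gapCount, G.adj_comm y x]
      omega

theorem isChain_of_gapCount_eq_zero (l : List V) (h : gapCount G l = 0) : l.IsChain G.Adj := by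
  induction l with
  | nil => simp
  | cons x l ih =>
    cases l with
    | nil => simp
    | cons y l =>
      simp only [gapCount, Nat.add_eq_zero_iff, ite_eq_left_iff, one_ne_zero, imp_false,
        not_not] at h
      exact List.isChain_cons_cons.2 ⟨h.1, ih h.2⟩

theorem exists_gap_of_gapCount_ne_zero (l : List V) (h : gapCount G l ≠ 0) :
    ∃ l₁ x y l₂, l = l₁ ++ x :: y :: l₂ ∧ ¬ G.Adj x y := by
  induction l with
  | nil => simp [gapCount] at h
  | cons x l ih =>
    cases l with
    | nil => simp [gapCount] at h
    | cons y l =>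
      by_cases hxy : G.Adj x y
      · obtain ⟨l₁, a, b, l₂, he, hab⟩ := ih (by simpa [gapCount, hxy] using h)
        exact ⟨x :: l₁, a, b, l₂, by simp [he], hab⟩
      · exact ⟨[], x, y, l, rfl, hxy⟩

/-- Pigeonhole on a list: if `a` and `b` hold often enough, then `b` holds at the head, or `a` at
the last entry, or `a` and `b` hold at two consecutive entries. -/
theorem exists_consecutive_of_length_le_countP (a b : V → Bool) (l : List V) (z : V)
    (h : l.length + 1 ≤ (z :: l).countP a + (z :: l).countP b) :
    b z = true ∨ (∃ l₁ x, z :: l = l₁ ++ [x] ∧ a x = true) ∨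
      ∃ l₁ x y l₂, z :: l = l₁ ++ x :: y :: l₂ ∧ a x = true ∧ b y = true := by
  by_cases hb : b z = true
  · exact .inl hb
  refine .inr ?_
  -- Now `b` is counted on the tail only. Without a consecutive pair, each junction carries at most
  -- one hit, leaving one for `a` at the last entry.
  rw [List.countP_cons_of_neg (p := b) hb] at h
  clear hb
  induction l generalizing z with
  | nil =>
    refine .inl ⟨[], z, rfl, ?_⟩
    by_contra hz
    simp [hz] at h
  | cons y l ih =>
    by_cases hzy : a z = true ∧ b y = true
    · exact .inr ⟨[], z, y, l, rfl, hzy⟩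
    · have h' : l.length + 1 ≤ (y :: l).countP a + l.countP b := by
        rw [List.countP_cons, List.countP_cons (p := b)] at h
        simp only [List.length_cons] at h
        by_cases hz : a z = true <;> by_cases hy : b y = true <;> simp_all <;> omega
      rcases ih y h' with ⟨l₁, x, he, hx⟩ | ⟨l₁, x, w, l₂, he, hx, hw⟩
      · exact .inl ⟨z :: l₁, x, by simp [he], hx⟩
      · exact .inr ⟨z :: l₁, x, w, l₂, by simp [he], hx, hw⟩

/-- Rotation step: across a gap `u, v` whose ends have large enough total degree, reversing a
segment decreases the number of gaps. -/
theorem exists_perm_gapCount_lt (p q : List V) (u v : V) (huv : ¬ G.Adj u v)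
    (h : (p ++ u :: v :: q).length ≤ (p ++ u :: v :: q).countP (G.Adj u ·) +
      (p ++ u :: v :: q).countP (G.Adj v ·) + 1) :
    ∃ l : List V, l.Perm (p ++ u :: v :: q) ∧ gapCount G l < gapCount G (p ++ u :: v :: q) := by
  have hgap := gapCount_append G p q u v
  rw [if_neg huv] at hgap
  have hsplit : p ++ u :: v :: q = (p ++ [u]) ++ (v :: q) := by simp
  rw [hsplit, List.countP_append (l₁ := p ++ [u]), List.countP_append (l₁ := p ++ [u]),
    List.length_append] at h
  -- The slack of 1 in `h` cannot be exceeded by a deficit in both halves.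
  have hor : (p ++ [u]).length ≤ (p ++ [u]).countP (G.Adj u ·) + (p ++ [u]).countP (G.Adj v ·) ∨
      (v :: q).length ≤ (v :: q).countP (G.Adj u ·) + (v :: q).countP (G.Adj v ·) := by omega
  rcases hor with hP | hQ
  · obtain ⟨z, t, hzt⟩ : ∃ z t, p ++ [u] = z :: t := List.exists_cons_of_ne_nil (by simp)
    rw [hzt, List.length_cons] at hP
    rcases exists_consecutive_of_length_le_countP _ _ _ _ hP with
      hb | ⟨l₁, x, he, hx⟩ | ⟨l₁, x, y, l₂, he, hx, hy⟩
    -- Reversing the left half joins `z` to `v`.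
    · have hvz : G.Adj v z := by simpa using hb
      refine ⟨(p ++ [u]).reverse ++ v :: q, ?_, ?_⟩
      · rw [hsplit]
        exact (List.reverse_perm _).append_right _
      · have := gapCount_append G t.reverse q z v
        rw [if_pos hvz.symm, ← List.reverse_cons, gapCount_reverse] at this
        rw [hgap, hzt, List.reverse_cons, List.append_assoc, List.cons_append, List.nil_append,
          this]
        omega
    · rw [← hzt] at he
      obtain ⟨-, rfl⟩ := List.append_singleton_inj.1 he
      simp at hx
    -- Reversing the segment from `y` to `u` replaces the junctions xy and uv by the edges xu and
    -- yv.
    · rw [← hzt] at he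
      have hux : G.Adj u x := by simpa using hx
      have hvy : G.Adj v y := by simpa using hy
      obtain ⟨r, hr⟩ : ∃ r, y :: l₂ = r ++ [u] := by
        refine ⟨(y :: l₂).dropLast, ?_⟩
        have h1 := congrArg List.getLast? he
        simp only [List.getLast?_append, List.getLast?_cons_cons, List.getLast?_singleton] at h1
        have h2 : (y :: l₂).getLast? = some u := by
          rw [List.getLast?_eq_getLast_of_ne_nil (List.cons_ne_nil _ _)] at h1 ⊢
          simpa using h1.symm
        rw [List.dropLast_append_getLast? _ h2]
      refine ⟨l₁ ++ x :: ((y :: l₂).reverse ++ v :: q), ?_, ?_⟩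
      · rw [hsplit, he, List.append_assoc]
        refine List.Perm.append_left _ (List.Perm.cons _ ?_)
        exact (List.reverse_perm _).append_right _
      · have e1 := gapCount_append G l₁ l₂ x y
        rw [← he] at e1
        have e2 : gapCount G (l₁ ++ x :: ((y :: l₂).reverse ++ v :: q)) =
            gapCount G (l₁ ++ [x]) + gapCount G ((y :: l₂).reverse ++ v :: q) := by
          rw [hr, List.reverse_append, List.reverse_singleton, List.cons_append, List.cons_append,
            gapCount_append, if_pos hux.symm]
          simp
        have e3 : gapCount G ((y :: l₂).reverse ++ v :: q) =
            gapCount G (y :: l₂) + gapCount G (v :: q) := by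
          have := gapCount_append G l₂.reverse q y v
          rw [if_pos hvy.symm, ← List.reverse_cons, gapCount_reverse] at this
          simpa using this
        rw [hgap, e2, e3]
        omega
  · rw [List.length_cons] at hQ
    rcases exists_consecutive_of_length_le_countP _ _ _ _ hQ with
      hb | ⟨l₁, x, he, hx⟩ | ⟨l₁, x, y, l₂, he, hx, hy⟩
    · simp at hb
    · have hux : G.Adj u x := by simpa using hx
      refine ⟨(p ++ [u]) ++ (v :: q).reverse, ?_, ?_⟩
      · rw [hsplit]
        exact (List.reverse_perm _).append_left _
      · have := gapCount_append G p l₁.reverse u x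
        rw [if_pos hux] at this
        have e : x :: l₁.reverse = (v :: q).reverse := by rw [he]; simp
        rw [e, gapCount_reverse] at this
        rw [hgap, List.append_assoc, List.singleton_append, this]
        omega
    -- Mirror image: reversing the segment from `v` to `x` creates the edges ux and vy.
    · have hux : G.Adj u x := by simpa using hx
      have hvy : G.Adj v y := by simpa using hy
      obtain ⟨r, hr⟩ : ∃ r, l₁ ++ [x] = v :: r := by
        cases l₁ with
        | nil => exact ⟨[], by simp_all⟩
        | cons a l₁ => exact ⟨l₁ ++ [x], by simp_all⟩
      have hvq : v :: q = (l₁ ++ [x]) ++ (y :: l₂) := by simp [he]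
      refine ⟨(p ++ [u]) ++ ((l₁ ++ [x]).reverse ++ y :: l₂), ?_, ?_⟩
      · rw [hsplit, hvq]
        exact ((List.reverse_perm _).append_right _).append_left _
      · have e1 := gapCount_append G l₁ l₂ x y
        rw [← he] at e1
        have e2 : gapCount G ((p ++ [u]) ++ ((l₁ ++ [x]).reverse ++ y :: l₂)) =
            gapCount G (p ++ [u]) + gapCount G ((l₁ ++ [x]).reverse ++ y :: l₂) := by
          rw [List.reverse_append, List.reverse_singleton, List.append_assoc, List.append_assoc,
            List.singleton_append, List.singleton_append]
          have := gapCount_append G p (l₁.reverse ++ y :: l₂) u x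
          rw [if_pos hux] at this
          simpa using this
        have e3 : gapCount G ((l₁ ++ [x]).reverse ++ y :: l₂) =
            gapCount G (l₁ ++ [x]) + gapCount G (y :: l₂) := by
          have := gapCount_append G r.reverse l₂ v y
          rw [if_pos hvy, ← List.reverse_cons, ← hr, gapCount_reverse] at this
          rw [hr, List.reverse_cons, ← hr]
          simpa using this
        rw [hgap, e2, e3]
        omega

theorem countP_adj_eq_degree [Fintype V] {l : List V} (hl : l.Nodup) (hmem : ∀ v, v ∈ l) (u : V) :
    l.countP (G.Adj u ·) = G.degree u := by
  classical
  rw [List.countP_eq_length_filter, ← List.toFinset_card_of_nodup (hl.filter _),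
    ← SimpleGraph.card_neighborFinset_eq_degree]
  congr 1
  ext w
  simp [hmem]

/-- **Ore's theorem** for Hamiltonian paths: if non-adjacent vertices have degree sum at least
`|V| - 1`, the vertices can be listed without repetition so that consecutive ones are adjacent. -/
theorem exists_isChain_of_ore [Fintype V]
    (h : ∀ x y, x ≠ y → ¬ G.Adj x y → Fintype.card V - 1 ≤ G.degree x + G.degree y) :
    ∃ l : List V, l.Nodup ∧ (∀ v, v ∈ l) ∧ l.IsChain G.Adj := by
  classical
  -- Take an ordering of the vertices with fewest gaps; a remaining gap would allow a rotation.
  obtain ⟨l, ⟨hl, hmem⟩, hmin⟩ := WellFounded.has_min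
    (InvImage.wf (gapCount G) Nat.lt_wfRel.wf) {l : List V | l.Nodup ∧ ∀ v, v ∈ l}
    ⟨univ.toList, nodup_toList _, by simp⟩
  refine ⟨l, hl, hmem, isChain_of_gapCount_eq_zero G l ?_⟩
  by_contra hne
  obtain ⟨p, u, v, q, rfl, huv⟩ := exists_gap_of_gapCount_ne_zero G l hne
  have hne : u ≠ v := by
    rintro rfl
    have := (List.nodup_append.1 hl).2.1
    simp at this
  have hlen : (p ++ u :: v :: q).length = Fintype.card V := by
    rw [← List.toFinset_card_of_nodup hl, ← card_univ]
    congr 1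
    ext w
    exact iff_of_true (List.mem_toFinset.2 (hmem w)) (Finset.mem_univ w)
  obtain ⟨l', hperm, hlt⟩ := exists_perm_gapCount_lt G p q u v huv (by
    rw [countP_adj_eq_degree G hl hmem, countP_adj_eq_degree G hl hmem, hlen]
    have := h u v hne huv
    omega)
  exact hmin l' ⟨hperm.nodup_iff.2 hl, fun w => hperm.mem_iff.2 (hmem w)⟩ hlt

end Ore

/-! ### Path graphs, their leaves, and transport along isomorphisms -/

section Path

theorem isTree_pathGraph (n : ℕ) : (SimpleGraph.pathGraph (n + 1)).IsTree := by
  have hc := SimpleGraph.pathGraph_connected n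
  refine SimpleGraph.isTree_iff_connected_and_card.2 ⟨hc, le_antisymm ?_ ?_⟩
  · have hsub : (SimpleGraph.pathGraph (n + 1)).edgeSet ⊆
        Set.range fun i : Fin n => s(i.castSucc, i.succ) := by
      intro e
      induction e using Sym2.ind with
      | _ a b =>
        intro hab
        rw [SimpleGraph.mem_edgeSet, SimpleGraph.pathGraph_adj] at hab
        rcases hab with hab | hab
        · exact ⟨⟨a, by omega⟩, by
            rw [Sym2.eq_iff]
            exact .inl ⟨rfl, Fin.ext (by simpa using hab)⟩⟩
        · exact ⟨⟨b, by omega⟩, by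
            rw [Sym2.eq_iff]
            exact .inr ⟨rfl, Fin.ext (by simpa using hab)⟩⟩
    have h1 := Nat.card_mono (Set.finite_range _) hsub
    have h2 := Finite.card_range_le fun i : Fin n => s(i.castSucc, i.succ)
    rw [Nat.card_fin] at h2 ⊢
    omega
  · exact hc.card_vert_le_card_edgeSet_add_one

/-- Each step raises the index by at most one; this bounds the distance between the ends from below.
-/
theorem le_add_length_of_walk_pathGraph {n : ℕ} {i j : Fin n}
    (w : (SimpleGraph.pathGraph n).Walk i j) : (j : ℕ) ≤ i + w.length := by
  induction w with
  | nil => simp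
  | cons h _ ih =>
    rw [SimpleGraph.pathGraph_adj] at h
    rw [SimpleGraph.Walk.length_cons]
    omega

theorem isLeaf_pathGraph_iff {n : ℕ} (i : Fin (n + 2)) :
    IsLeaf (SimpleGraph.pathGraph (n + 2)) i ↔ (i : ℕ) = 0 ∨ (i : ℕ) = n + 1 := by
  rw [IsLeaf, Set.ncard_eq_one]
  constructor
  · rintro ⟨a, ha⟩
    by_contra! hne
    have h1 : (⟨i + 1, by omega⟩ : Fin (n + 2)) ∈ (SimpleGraph.pathGraph (n + 2)).neighborSet i := by
      simp [SimpleGraph.pathGraph_adj]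
    have h2 : (⟨i - 1, by omega⟩ : Fin (n + 2)) ∈ (SimpleGraph.pathGraph (n + 2)).neighborSet i := by
      simp [SimpleGraph.pathGraph_adj]
      omega
    rw [ha, Set.mem_singleton_iff] at h1 h2
    have := congrArg Fin.val (h1.trans h2.symm)
    simp at this
    omega
  · rintro (h | h)
    · refine ⟨⟨1, by omega⟩, Set.ext fun j => ?_⟩
      simp only [SimpleGraph.mem_neighborSet, SimpleGraph.pathGraph_adj, Set.mem_singleton_iff,
        Fin.ext_iff]
      omega
    · refine ⟨⟨n, by omega⟩, Set.ext fun j => ?_⟩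
      simp only [SimpleGraph.mem_neighborSet, SimpleGraph.pathGraph_adj, Set.mem_singleton_iff,
        Fin.ext_iff]
      omega

theorem leafDist_pathGraph (n : ℕ) : leafDist (SimpleGraph.pathGraph (n + 2)) = n + 1 := by
  have hdist : (SimpleGraph.pathGraph (n + 2)).dist 0 (Fin.last (n + 1)) = n + 1 := by
    have hc : (SimpleGraph.pathGraph (n + 2)).Connected := SimpleGraph.pathGraph_connected (n + 1)
    refine le_antisymm ?_ ?_
    · obtain ⟨w, hw, hlen⟩ := hc.exists_path_of_dist 0 (Fin.last (n + 1))
      have := hw.length_lt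
      rw [Fintype.card_fin] at this
      omega
    · obtain ⟨w, hlen⟩ := hc.exists_walk_length_eq_dist 0 (Fin.last (n + 1))
      have := le_add_length_of_walk_pathGraph w
      rw [hlen] at this
      simpa using this
  have hset : {k | ∃ u v, u ≠ v ∧ IsLeaf (SimpleGraph.pathGraph (n + 2)) u ∧
      IsLeaf (SimpleGraph.pathGraph (n + 2)) v ∧ (SimpleGraph.pathGraph (n + 2)).dist u v = k} =
      {n + 1} := by
    ext k
    simp only [Set.mem_ofPred_eq, Set.mem_singleton_iff, isLeaf_pathGraph_iff]
    constructor
    · rintro ⟨u, v, huv, hu | hu, hv | hv, rfl⟩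
      · exact absurd (Fin.ext (hu.trans hv.symm)) huv
      · rw [show u = 0 from Fin.ext hu, show v = Fin.last (n + 1) from Fin.ext hv, hdist]
      · rw [show v = 0 from Fin.ext hv, show u = Fin.last (n + 1) from Fin.ext hu,
          SimpleGraph.dist_comm, hdist]
      · exact absurd (Fin.ext (hu.trans hv.symm)) huv
    · rintro rfl
      exact ⟨0, Fin.last (n + 1), by simp [Fin.ext_iff], by simp, by simp, hdist⟩
  rw [leafDist, hset, csInf_singleton]

theorem dist_iso {V W : Type*} {G : SimpleGraph V} {H : SimpleGraph W} (e : G ≃g H) (u v : V) :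
    H.dist (e u) (e v) = G.dist u v := by
  rw [SimpleGraph.dist_eq_sInf, SimpleGraph.dist_eq_sInf]
  congr 1
  ext k
  constructor
  · rintro ⟨w, rfl⟩
    exact ⟨(w.map e.symm.toHom).copy (e.symm_apply_apply u) (e.symm_apply_apply v), by simp⟩
  · rintro ⟨w, rfl⟩
    exact ⟨w.map e.toHom, by simp⟩

theorem isLeaf_iso {V W : Type*} {G : SimpleGraph V} {H : SimpleGraph W} (e : G ≃g H) (v : V) :
    IsLeaf H (e v) ↔ IsLeaf G v := by
  rw [IsLeaf, IsLeaf, ← Nat.card_coe_set_eq, ← Nat.card_coe_set_eq,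
    Nat.card_congr (e.mapNeighborSet v)]

theorem leafDist_iso {V W : Type*} {G : SimpleGraph V} {H : SimpleGraph W} (e : G ≃g H) :
    leafDist G = leafDist H := by
  rw [leafDist, leafDist]
  congr 1
  ext k
  constructor
  · rintro ⟨u, v, huv, hu, hv, hk⟩
    exact ⟨e u, e v, e.injective.ne huv, (isLeaf_iso e u).2 hu, (isLeaf_iso e v).2 hv,
      (dist_iso e u v).trans hk⟩
  · rintro ⟨u, v, huv, hu, hv, hk⟩
    exact ⟨e.symm u, e.symm v, e.symm.injective.ne huv, (isLeaf_iso e.symm u).2 hu,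
      (isLeaf_iso e.symm v).2 hv, (dist_iso e.symm u v).trans hk⟩

/-- A Hamiltonian path is a spanning tree whose only two leaves are at distance `|V| - 1`. -/
theorem exists_isSpanningTree_of_isChain {V : Type*} (G : SimpleGraph V) {l : List V}
    (hl : l.Nodup) (hmem : ∀ v, v ∈ l) (hchain : l.IsChain G.Adj) (hlen : 2 ≤ l.length) :
    ∃ T : SimpleGraph V, IsSpanningTree T G ∧ leafDist T = l.length - 1 := by
  classical
  obtain ⟨n, hn⟩ := Nat.exists_eq_add_of_le' hlen
  let e : Fin l.length ≃ V := hl.getEquivOfForallMemList l hmem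
  let φ : (SimpleGraph.pathGraph l.length).comap e.symm ≃g SimpleGraph.pathGraph l.length :=
    SimpleGraph.Iso.comap e.symm _
  refine ⟨(SimpleGraph.pathGraph l.length).comap e.symm, ⟨?_, ?_⟩, ?_⟩
  · have key : ∀ i j : Fin l.length, (i : ℕ) + 1 = j → G.Adj (e i) (e j) := by
      rintro ⟨i, hi⟩ ⟨j, hj⟩ (rfl : i + 1 = j)
      exact List.isChain_iff_getElem.1 hchain i hj
    intro u v huv
    rw [SimpleGraph.comap_adj, SimpleGraph.pathGraph_adj] at huv
    rcases huv with huv | huv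
    · simpa using key _ _ huv
    · simpa using (key _ _ huv).symm
  · rw [φ.isTree_iff, hn]
    exact isTree_pathGraph (n + 1)
  · rw [leafDist_iso φ, hn]
    exact leafDist_pathGraph n

end Path

end LeafDistance

/-- The spectral hypothesis already makes `G` traceable: Hong's bound forces at least
`(n-1).choose 2 + 1` edges, and Ore's condition then yields a Hamiltonian path, which is a spanning
tree of leaf distance `n - 1 ≥ d`. The bound on the independence number is not needed. -/
theorem theorem1p1 {V : Type*} [Fintype V] (G : SimpleGraph V) (n d : ℕ)
    (hn : Fintype.card V = n) (hconn : G.Connected) (hα : G.indepNum ≤ 5)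
    (hd : 16 ≤ d ^ 2) (hdn : d ^ 2 ≤ n)
    (hρ : LeafDistance.rho (LeafDistance.extremalGraph n d) ≤ LeafDistance.rho G) :
    (∃ T : SimpleGraph V, LeafDistance.IsSpanningTree T G ∧ d ≤ LeafDistance.leafDist T) ∨
      Nonempty (G ≃g LeafDistance.extremalGraph n d) := by
  classical
  left
  have hd4 : 4 ≤ d := by nlinarith
  have hdn' : d + 1 ≤ n := by nlinarith
  have : Nontrivial V := Fintype.one_lt_card_iff_nontrivial.1 (by omega)
  have hdeg : ∀ v, 1 ≤ G.degree v := fun v => hconn.preconnected.degree_pos_of_nontrivial v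
  have hlow := (LeafDistance.sub_two_le_rho_extremalGraph (by omega) (by omega)
    (by omega : d ≤ n)).trans hρ
  have hup := LeafDistance.rho_sq_le G hdeg
  have hm : n * (n - 1) ≤ ∑ v, G.degree v + 2 * (n - 2) := by
    obtain ⟨k, rfl⟩ := Nat.exists_eq_add_of_le' (by omega : 2 ≤ n)
    rw [hn] at hup
    have e1 : k + 2 - 1 = k + 1 := by omega
    have e2 : k + 2 - 2 = k := by omega
    rw [e1] at hup
    rw [e1, e2]
    push_cast at hlow hup
    have hk : (k : ℝ) ^ 2 + (k + 1) ≤ ∑ v, (G.degree v : ℝ) := by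
      have : (0 : ℝ) ≤ k := by positivity
      nlinarith
    have hk' : k ^ 2 + (k + 1) ≤ ∑ v, G.degree v := by exact_mod_cast hk
    -- Parity gains the last unit: the degree sum is even, while k² + k + 1 is odd.
    have hpar : (k ^ 2 + k) % 2 = 0 := by
      rw [show k ^ 2 + k = k * (k + 1) by ring]
      exact Nat.even_iff.1 (Nat.even_mul_succ_self k)
    have hsum := G.sum_degrees_eq_twice_card_edges
    have : k ^ 2 + k + 2 ≤ ∑ v, G.degree v := by omega
    nlinarith
  obtain ⟨l, hl, hmem, hchain⟩ := LeafDistance.exists_isChain_of_ore G fun x y hxy h =>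
    LeafDistance.card_sub_one_le_degree_add_degree G (by rw [hn]; exact hm) hxy h
  have hlen : l.length = n := by
    rw [← hn, ← List.toFinset_card_of_nodup hl, ← Finset.card_univ]
    congr 1
    ext w
    exact iff_of_true (List.mem_toFinset.2 (hmem w)) (Finset.mem_univ w)
  obtain ⟨T, hT, hdist⟩ := LeafDistance.exists_isSpanningTree_of_isChain G hl hmem hchain
    (by omega)
  exact ⟨T, hT, by omega⟩
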